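/- A \emph{labelled tree} is a map $v:\{0,1\}^*\to\{0,1\}$; let $D$ be the set of all labelled trees, with the product topology. Let $$S=\{v\in D: v(x)=1 \text{ for exactly one } x\in\{0,1\}^*\},\qquad V=\{v\in D: \text{for every } \eta\in\{0,1\}^\omega \text{ only finitely many prefixes } x \text{ of } \eta \text{ have } v(x)=1\},$$ and let $\mathrm{Left}',\mathrm{Right}':D\to D$ be the shifts $\mathrm{Left}'(v)(x)=v(x0)$ and $\mathrm{Right}'(v)(x)=v(x1)$. A (nondeterministic) \emph{Rabin automaton} over a finite alphabet $A$ consists of a finite set $Q$ of states, an initial state $\iota$, a transition relation $\Delta\subseteq Q\times A\times Q\times Q$ and a family $\mathcal F\subseteq\mathcal P(Q)$. It accepts $v:\{0,1\}^*\to A$ if there is $r:\{0,1\}^*\to Q$ with $r(\lambda)=\iota$ ($\lambda$ the empty string) and $(r(x),v(x),r(x0),r(x1))\in\Delta$ for all $x$, such that for every infinite path the set of states that occur infinitely often on it belongs to $\mathcal F$. A (nondeterministic) \emph{Büchi automaton} over $A$ has instead a transition relation $\Delta\subseteq Q\times A\times Q$ and a set $F\subseteq Q$; it accepts $\alpha\in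 A^\omega$ if there is a sequence of states $q_0=\iota,q_1,\dots$ with $(q_i,\alpha(i),q_{i+1})\in\Delta$ for all $i$ in which some state of $F$ occurs infinitely often. A $k$-ary relation on $A$-labelled trees (on $A^\omega$) is Rabin (Büchi) recognizable if the set of its convolutions, which are trees (words) over the alphabet $A^k$, is the set of inputs accepted by some Rabin (Büchi) automaton. A structure is Rabin automatic, Büchi automatic, or Borel in a Polish space $X$, if its elements are $A$-labelled trees for a finite $A$, words in $A^\omega$ for a finite $A$, or points of $X$, respectively, and its domain, its basic relations and the graphs of its basic functions are Rabin recognizable, Büchi recognizable, or Borel sets, respectively. \textbf{Theorem} (Hjorth, Khoussainov, Montalbán, Nies; 2008). The structure $\mathcal A=(D;S,V,\mathrm{Left}',\mathrm{Right}')$ is Rabin automatic. It is not isomorphic to any Borel structure in $\{0,1\}^\omega$, nor to one in any other Polish space, and it is not isomorphic to any Büchi automatic structure. In particular, there is a Rabin automatic structure without a Borel presentation and hence without a Büchi automatic presentation. Moreover, there is a continuous map $f:\{0,1\}^{\omega^{<\omega}}\to D$ such that, for every $T\subseteq\omega^{<\omega}$ closed under prefixes (identified with its characteristic function), $f(T)\in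 V$ if and only if $T$ has no infinite path; and $V$ is not a Borel subset of $D$. -/

import Mathlib

open scoped FirstOrder

namespace AutStr

/-! ### Infinite words, infinite binary trees, convolutions -/

/-- Nodes of the full binary tree: finite binary strings (`false` is `0`, `true` is `1`). -/
abbrev Node : Type := List Bool

/-- The left successor appends `0`. -/
def Node.left (x : Node) : Node := x ++ [false]

/-- The right successor appends `1`. -/
def Node.right (x : Node) : Node := x ++ [true]

/-- The `A`-labelled full binary trees. -/
abbrev Tree (A : Type) : Type := Node → A

/-- The infinite words over `A`. -/
abbrev Word (A : Type) : Type := ℕ → A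

/-- The initial segment of length `n` of an infinite sequence. -/
def initSeg {A : Type} (η : ℕ → A) (n : ℕ) : List A := (List.range n).map η

/-- The convolution of a tuple of labellings of the same index set (`ℕ` for infinite words,
`Node` for trees). -/
def conv {I A : Type} {k : ℕ} (x : Fin k → I → A) : I → (Fin k → A) := fun p j => x j p

/-! ### Büchi automata on infinite words -/

/-- A (nondeterministic) Büchi automaton over the alphabet `A`. -/
structure BuchiAutomaton (A : Type) where
  State : Type
  finite_state : Finite State
  init : State
  trans : Set (State × A × State)
  acc : Set State

/-- Some run on `α` visits some accepting state infinitely often. -/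
def BuchiAutomaton.Accepts {A : Type} (M : BuchiAutomaton A) (α : Word A) : Prop :=
  ∃ r : ℕ → M.State, r 0 = M.init ∧ (∀ i, (r i, α i, r (i + 1)) ∈ M.trans) ∧
    ∃ s ∈ M.acc, {i | r i = s}.Infinite

/-- A relation on infinite words is Büchi recognizable if the set of convolutions of its tuples is
the language of some Büchi automaton. -/
def BuchiRecognizable (A : Type) (k : ℕ) (R : Set (Fin k → Word A)) : Prop :=
  ∃ M : BuchiAutomaton (Fin k → A), {α | M.Accepts α} = conv '' R

/-! ### Rabin automata on infinite trees -/

/-- A (nondeterministic) Rabin automaton over the alphabet `A`; the acceptance condition is a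
family of sets of states. -/
structure RabinAutomaton (A : Type) where
  State : Type
  finite_state : Finite State
  init : State
  trans : Set (State × A × State × State)
  acc : Set (Set State)

/-- The runs of a Rabin automaton on a labelled tree. -/
def RabinAutomaton.IsRun {A : Type} (M : RabinAutomaton A) (v : Tree A) (r : Node → M.State) :
    Prop :=
  r [] = M.init ∧ ∀ x : Node, (r x, v x, r (Node.left x), r (Node.right x)) ∈ M.trans

/-- The set of states that occur infinitely often on the path `η`. -/
def infStates {S : Type} (r : Node → S) (η : ℕ → Bool) : Set S :=
  {s | {n | r (initSeg η n) = s}.Infinite}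

/-- Some run on `v` satisfies the acceptance condition on every path. -/
def RabinAutomaton.Accepts {A : Type} (M : RabinAutomaton A) (v : Tree A) : Prop :=
  ∃ r : Node → M.State, M.IsRun v r ∧ ∀ η : ℕ → Bool, infStates r η ∈ M.acc

/-- A relation on labelled trees is Rabin recognizable if the set of convolutions of its tuples is
the language of some Rabin automaton. -/
def RabinRecognizable (A : Type) (k : ℕ) (R : Set (Fin k → Tree A)) : Prop :=
  ∃ M : RabinAutomaton (Fin k → A), {v | M.Accepts v} = conv '' R

/-! ### Borel relations -/

/-- A relation on a topological space is Borel if it is a Borel set in the product topology. -/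
def BorelRel (X : Type*) [TopologicalSpace X] (k : ℕ) (R : Set (Fin k → X)) : Prop :=
  @MeasurableSet (Fin k → X) (borel (Fin k → X)) R

/-! ### Structures whose domain, basic relations and basic functions belong to a given class -/

/-- Let the elements of the structure `M` be points of the space `X` by means of the inclusion `e`.
The domain, the basic relations and the graphs of the basic functions all belong to the class `C`
of relations on `X`. -/
def StructureIn {X M : Type*} (C : (k : ℕ) → Set (Fin k → X) → Prop)
    (L : FirstOrder.Language.{0, 0}) [L.Structure M] (e : M → X) : Prop :=
  C 1 {x | ∃ a : M, x = fun _ => e a} ∧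
  (∀ (n : ℕ) (R : L.Relations n),
    C n {x | ∃ a : Fin n → M, FirstOrder.Language.Structure.RelMap R a ∧ x = fun i => e (a i)}) ∧
  (∀ (n : ℕ) (f : L.Functions n),
    C (n + 1) {x | ∃ a : Fin n → M,
      x = Fin.snoc (α := fun _ => X) (fun i => e (a i)) (e (FirstOrder.Language.Structure.funMap f a))})

/-- `M` is isomorphic to a structure whose domain is a subset of `X` and whose domain, relations
and functions belong to the class `C`. -/
def HasPresentation {X : Type*} (C : (k : ℕ) → Set (Fin k → X) → Prop)
    (L : FirstOrder.Language.{0, 0}) (M : Type*) [L.Structure M] : Prop :=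
  ∃ (D : Set X) (_ : L.Structure D),
    StructureIn C L (Subtype.val : D → X) ∧ Nonempty (M ≃[L] D)

/-- A structure whose elements are all the `A`-labelled trees is Rabin automatic. -/
def IsRabinAutomatic (A : Type) (L : FirstOrder.Language.{0, 0}) [L.Structure (Tree A)] : Prop :=
  StructureIn (RabinRecognizable A) L (id : Tree A → Tree A)

/-- `M` is isomorphic to a Büchi automatic structure, over some finite alphabet. -/
def HasBuchiPresentation (L : FirstOrder.Language.{0, 0}) (M : Type*) [L.Structure M] : Prop :=
  ∃ (A : Type) (_ : Finite A), HasPresentation (BuchiRecognizable A) L M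

/-- `M` is isomorphic to a Borel structure with domain a Borel subset of `X`. -/
def HasBorelPresentation (X : Type*) [TopologicalSpace X] (L : FirstOrder.Language.{0, 0}) (M : Type*)
    [L.Structure M] : Prop :=
  HasPresentation (BorelRel X) L M

/-! ### The structure of `{0,1}`-labelled trees -/

/-- Exactly one node has label `1`. -/
def treeS : Set (Tree Bool) := {v | ∃! x : Node, v x = true}

/-- Every path has only finitely many nodes with label `1`. -/
def treeV : Set (Tree Bool) := {v | ∀ η : ℕ → Bool, {n | v (initSeg η n) = true}.Finite}

/-- The left shift: the label of `x` in the new tree is the old label of the left successor. -/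
def treeLeft (v : Tree Bool) : Tree Bool := fun x => v (Node.left x)

/-- The right shift: the label of `x` in the new tree is the old label of the right successor. -/
def treeRight (v : Tree Bool) : Tree Bool := fun x => v (Node.right x)

/-- Two unary function symbols. -/
inductive TreeFun : ℕ → Type
  | left : TreeFun 1
  | right : TreeFun 1

/-- Two unary relation symbols. -/
inductive TreeRel : ℕ → Type
  | S : TreeRel 1
  | V : TreeRel 1

/-- The language with unary predicates `S`, `V` and unary functions `Left'`, `Right'`. -/
def treeLang : FirstOrder.Language.{0, 0} := ⟨TreeFun, TreeRel⟩

/-- The structure on the set of all `{0,1}`-labelled trees. -/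
instance treeStructure : treeLang.Structure (Tree Bool) where
  funMap := fun {_} f =>
    match f with
    | TreeFun.left => fun a => treeLeft (a 0)
    | TreeFun.right => fun a => treeRight (a 0)
  RelMap := fun {_} R =>
    match R with
    | TreeRel.S => fun a => a 0 ∈ treeS
    | TreeRel.V => fun a => a 0 ∈ treeV

end AutStr

/-!
`V` is well-foundedness in disguise: labelling with `1` the codes of the sequences in a tree `T` of
finite sequences of natural numbers, where codes preserve and reflect prefixes, gives a labelled
tree in `V` exactly if `T` has no infinite path, and it depends continuously on `T`.

Well-foundedness is not analytic. Given a continuous map `g` from Baire space to trees, the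
*diagonal tree* consists of the attempts to find a point that `g` maps to this very tree. An
infinite path through it is such a point, so it has an infinite path exactly if it lies in the range
of `g`; hence this range is not the set of well-founded trees.

Now let the structure be embedded by `e` into a Polish space, with analytic domain, relations and
graphs. Since no code is a proper suffix of another one, shifting the tree of codes of `T` by the
code of any member of `T` gives the same tree, the one whose only label `1` is at the root. So `T`
is well-founded exactly if some `v ∈ V` is turned into this tree by the shifts along all codes of
members of `T`. The family `x ↦ e (v shifted by x)` is determined step by step by the graphs of the
two shifts, so this condition is analytic in the single parameter `e` of that tree, and
well-foundedness would be analytic. Borel sets are analytic, and so are Büchi languages, as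
projections of the Borel sets of pairs of a word and an accepting run on it.
-/

namespace AutStr

open MeasureTheory Filter Topology

/-! ### Infinite branches and prefix chains -/

section Branches

variable {A : Type}

@[simp]
theorem initSeg_length (η : ℕ → A) (n : ℕ) : (initSeg η n).length = n := by
  simp [initSeg]

theorem initSeg_succ (η : ℕ → A) (n : ℕ) : initSeg η (n + 1) = initSeg η n ++ [η n] := by
  simp [initSeg, List.range_succ]

theorem initSeg_eq_initSeg_iff {η ξ : ℕ → A} {n : ℕ} :
    initSeg η n = initSeg ξ n ↔ ∀ i < n, η i = ξ i := by
  simp [initSeg]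

theorem take_initSeg (η : ℕ → A) {m n : ℕ} (h : m ≤ n) :
    (initSeg η n).take m = initSeg η m := by
  simp [initSeg, ← List.map_take, List.take_range, h]

theorem initSeg_prefix_initSeg (η : ℕ → A) {m n : ℕ} (h : m ≤ n) :
    initSeg η m <+: initSeg η n :=
  take_initSeg η h ▸ List.take_prefix m _

theorem initSeg_injective (η : ℕ → A) : Function.Injective (initSeg η) := fun m n h => by
  simpa using congrArg List.length h

theorem isChain_range_initSeg (η : ℕ → A) : IsChain (· <+: ·) (Set.range (initSeg η)) := by
  rintro _ ⟨m, rfl⟩ _ ⟨n, rfl⟩ -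
  exact (le_total m n).imp (initSeg_prefix_initSeg η) (initSeg_prefix_initSeg η)

theorem injOn_length_of_isChain {C : Set (List A)} (hC : IsChain (· <+: ·) C) :
    Set.InjOn List.length C := fun _ hs _ ht hst =>
  (hC.total hs ht).elim (·.eq_of_length hst) fun h => (h.eq_of_length hst.symm).symm

theorem exists_forall_initSeg_length_eq {C : Set (List A)} (hinf : C.Infinite)
    (hC : IsChain (· <+: ·) C) : ∃ η : ℕ → A, ∀ s ∈ C, initSeg η s.length = s := by
  have hlong : ∀ n, ∃ t ∈ C, n < t.length := fun n => by
    obtain ⟨_, ⟨t, ht, rfl⟩, hn⟩ := (hinf.image (injOn_length_of_isChain hC)).exists_gt n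
    exact ⟨t, ht, hn⟩
  choose t htC ht using hlong
  refine ⟨fun n => (t n)[n]'(ht n), fun s hs => List.ext_getElem (initSeg_length _ _) ?_⟩
  intro i _ hi
  simp only [initSeg, List.getElem_map, List.getElem_range]
  rcases hC.total hs (htC i) with h | h
  · exact (h.getElem hi).symm
  · exact h.getElem (ht i)

theorem exists_infinite_initSeg_mem_iff (L : Set (List A)) :
    (∃ η : ℕ → A, {n | initSeg η n ∈ L}.Infinite) ↔
      ∃ C ⊆ L, C.Infinite ∧ IsChain (· <+: ·) C := by
  constructor
  · rintro ⟨η, hη⟩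
    exact ⟨initSeg η '' {n | initSeg η n ∈ L}, Set.image_subset_iff.2 fun _ hn => hn,
      hη.image (initSeg_injective η).injOn,
      (isChain_range_initSeg η).mono (Set.image_subset_range _ _)⟩
  · rintro ⟨C, hCL, hinf, hC⟩
    obtain ⟨η, hη⟩ := exists_forall_initSeg_length_eq hinf hC
    refine ⟨η, (hinf.image (injOn_length_of_isChain hC)).mono ?_⟩
    rintro _ ⟨s, hs, rfl⟩
    simpa only [Set.mem_ofPred_eq, hη s hs] using hCL hs

/-- A tree of finite sequences over `A`, given by its characteristic function. -/
def PrefixClosed (T : List A → Bool) : Prop :=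
  ∀ s t : List A, T (s ++ t) = true → T s = true

/-- `T` is ill-founded: some infinite sequence has all its initial segments in `T`. -/
def HasPath (T : List A → Bool) : Prop :=
  ∃ α : ℕ → A, ∀ n, T (initSeg α n) = true

theorem PrefixClosed.eq_true_of_prefix {T : List A → Bool} (hT : PrefixClosed T) {s t : List A}
    (hst : s <+: t) (ht : T t = true) : T s = true := by
  obtain ⟨u, rfl⟩ := hst
  exact hT s u ht

theorem prefixClosed_of_forall_concat {T : List A → Bool}
    (hT : ∀ s a, T (s ++ [a]) = true → T s = true) : PrefixClosed T := by
  intro s t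
  induction t using List.reverseRecOn with
  | nil => simp
  | append_singleton t a ih => exact fun h => ih (hT _ a (by rwa [List.append_assoc]))

theorem PrefixClosed.hasPath_iff {T : List A → Bool} (hT : PrefixClosed T) :
    HasPath T ↔ ∃ C ⊆ {s | T s = true}, C.Infinite ∧ IsChain (· <+: ·) C := by
  rw [← exists_infinite_initSeg_mem_iff]
  refine exists_congr fun α => ⟨fun hα => ?_, fun hα n => ?_⟩
  · simpa [hα] using Set.infinite_univ (α := ℕ)
  · obtain ⟨m, hm, hnm⟩ := hα.exists_gt n
    exact hT.eq_true_of_prefix (initSeg_prefix_initSeg α hnm.le) hm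

theorem PrefixClosed.isChain_of_subsingleton_children {T : List A → Bool} (hT : PrefixClosed T)
    (hchild : ∀ s a b, T (s ++ [a]) = true → T (s ++ [b]) = true → a = b) :
    IsChain (· <+: ·) {s | T s = true} := by
  have comparable : ∀ y z u : List A, T (u ++ y) = true → T (u ++ z) = true →
      y <+: z ∨ z <+: y := by
    intro y
    induction y with
    | nil => simp
    | cons a y ih =>
      rintro (_ | ⟨b, z⟩) u hy hz
      · simp
      · rw [List.append_cons] at hy hz
        obtain rfl := hchild u a b (hT _ _ hy) (hT _ _ hz)
        simpa only [List.prefix_cons_inj] using ih z _ hy hz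
  exact fun y hy z hz _ => comparable y z [] hy hz

theorem notMem_treeV_iff {v : Tree Bool} :
    v ∉ treeV ↔ ∃ C ⊆ {x | v x = true}, C.Infinite ∧ IsChain (· <+: ·) C := by
  rw [← exists_infinite_initSeg_mem_iff]
  simp only [treeV, Set.mem_ofPred_eq, not_forall, Set.Infinite]

theorem finite_of_mem_treeV_of_isChain {v : Tree Bool} (hv : v ∈ treeV)
    (hchain : IsChain (· <+: ·) {x | v x = true}) : {x | v x = true}.Finite := by
  by_contra hinf
  exact notMem_treeV_iff.2 ⟨_, subset_rfl, hinf, hchain⟩ hv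

theorem treeV_antitone {u v : Tree Bool} (huv : ∀ x, u x = true → v x = true) (hv : v ∈ treeV) :
    u ∈ treeV := fun η => (hv η).subset fun _ => huv _

end Branches

/-! ### Well-foundedness is not analytic -/

section Diagonal

variable {A : Type}

open Classical in
/-- The tree of attempts to find a point that `g` maps to this very tree: it contains `t` when some
extension `z` of `t` has an image under `g` which is correct at all sequences shorter than `t`. The
definition is by recursion on the length of `t`. -/
noncomputable def diagonalTree (g : (ℕ → A) → List A → Bool) (t : List A) : Bool :=
  decide (∃ z, initSeg z t.length = t ∧
    ∀ s : List A, s.length < t.length → g z s = diagonalTree g s)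
termination_by t.length

theorem diagonalTree_eq_true_iff (g : (ℕ → A) → List A → Bool) (t : List A) :
    diagonalTree g t = true ↔ ∃ z, initSeg z t.length = t ∧
      ∀ s : List A, s.length < t.length → g z s = diagonalTree g s := by
  rw [diagonalTree, @decide_eq_true_iff _ (_)]

theorem prefixClosed_diagonalTree (g : (ℕ → A) → List A → Bool) :
    PrefixClosed (diagonalTree g) := by
  intro s t h
  obtain ⟨z, hz, hg⟩ := (diagonalTree_eq_true_iff _ _).1 h
  have hle : s.length ≤ (s ++ t).length := by simp
  refine (diagonalTree_eq_true_iff _ _).2 ⟨z, ?_, fun u hu => hg u (hu.trans_le hle)⟩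
  rw [← take_initSeg z hle, hz, List.take_left]

theorem tendsto_of_forall_initSeg_eq [TopologicalSpace A] {z : ℕ → ℕ → A} {y : ℕ → A}
    (h : ∀ n, initSeg (z n) n = initSeg y n) : Tendsto z atTop (𝓝 y) := by
  refine tendsto_pi_nhds.2 fun k => tendsto_const_nhds.congr' ?_
  filter_upwards [eventually_gt_atTop k] with n hn
  exact (initSeg_eq_initSeg_iff.1 (h n) k hn).symm

theorem hasPath_diagonalTree_iff [TopologicalSpace A] {g : (ℕ → A) → List A → Bool}
    (hg : Continuous g) : HasPath (diagonalTree g) ↔ diagonalTree g ∈ Set.range g := by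
  refine exists_congr fun y => ?_
  simp only [diagonalTree_eq_true_iff, initSeg_length]
  constructor
  · intro hy
    choose z hz hgz using hy
    have hlim : Tendsto (fun n => g (z n)) atTop (𝓝 (g y)) :=
      (hg.tendsto y).comp (tendsto_of_forall_initSeg_eq hz)
    refine tendsto_nhds_unique hlim (tendsto_pi_nhds.2 fun s => tendsto_const_nhds.congr' ?_)
    filter_upwards [eventually_gt_atTop s.length] with n hn
    exact (hgz n s hn).symm
  · exact fun hy n => ⟨y, rfl, fun s _ => congrFun hy s⟩

theorem not_analyticSet_of_forall_mem_iff_not_hasPath {P : Set (List ℕ → Bool)}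
    (hP : ∀ T, PrefixClosed T → (T ∈ P ↔ ¬ HasPath T)) : ¬ AnalyticSet P := by
  intro h
  rw [AnalyticSet] at h
  obtain rfl | ⟨g, hg, rfl⟩ := h
  · have hempty : ¬ HasPath fun _ : List ℕ => false := by simp [HasPath]
    exact (hP _ fun _ _ => id).2 hempty
  · have := hP _ (prefixClosed_diagonalTree g)
    rw [hasPath_diagonalTree_iff hg] at this
    exact iff_not_self this

end Diagonal

/-! ### Reduction of well-foundedness to `V` -/

section Coding

/-- The block `0…01` coding a natural number. -/
def natBlock (n : ℕ) : List Bool := List.replicate (n + 1) false ++ [true]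

/-- The code of a sequence of natural numbers. The marker `11` occurs in it only at the start, so
no code is a proper suffix of another one, and codes preserve and reflect prefixes. -/
def seqCode (s : List ℕ) : Node := true :: true :: s.flatMap natBlock

theorem natBlock_append_prefix_iff {m n : ℕ} {x y : List Bool} :
    natBlock m ++ x <+: natBlock n ++ y ↔ m = n ∧ x <+: y := by
  induction m generalizing n with
  | zero => cases n <;> simp [natBlock, List.replicate_succ, List.cons_prefix_cons]
  | succ m ih =>
    cases n with
    | zero => simp [natBlock, List.replicate_succ, List.cons_prefix_cons]
    | succ n =>
      have hcons : ∀ k, natBlock (k + 1) = false :: natBlock k := fun _ => rfl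
      rw [hcons, hcons, List.cons_append, List.cons_append, List.prefix_cons_inj, ih,
        Nat.add_right_cancel_iff]

theorem seqCode_prefix_seqCode_iff {s t : List ℕ} : seqCode s <+: seqCode t ↔ s <+: t := by
  simp only [seqCode, List.prefix_cons_inj]
  induction s generalizing t with
  | nil => simp
  | cons m s ih =>
    cases t with
    | nil => simp [natBlock]
    | cons n t =>
      rw [List.flatMap_cons, List.flatMap_cons, natBlock_append_prefix_iff, ih,
        List.cons_prefix_cons]

theorem seqCode_injective : Function.Injective seqCode := fun _ _ h =>
  antisymm (r := (· <+: ·)) (seqCode_prefix_seqCode_iff.1 (h ▸ List.prefix_rfl))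
    (seqCode_prefix_seqCode_iff.1 (h ▸ List.prefix_rfl))

theorem isChain_not_and_true_cons_flatMap_natBlock (s : List ℕ) :
    List.IsChain (fun a b : Bool => ¬ (a = true ∧ b = true)) (true :: s.flatMap natBlock) := by
  induction s with
  | nil => simp
  | cons n s ih =>
    have hzeros : List.IsChain (fun a b : Bool => ¬ (a = true ∧ b = true))
        (true :: List.replicate (n + 1) false) := by
      simp [List.isChain_cons, List.isChain_replicate_of_rel, List.replicate_succ]
    have hsplit : true :: (n :: s).flatMap natBlock =
        (true :: List.replicate (n + 1) false) ++ true :: s.flatMap natBlock := by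
      simp [natBlock]
    rw [hsplit, List.isChain_append]
    exact ⟨hzeros, ih, by simp [List.getLast?_cons, List.getLast?_replicate]⟩

theorem eq_nil_of_append_seqCode_eq_seqCode {z : Node} {s t : List ℕ}
    (h : z ++ seqCode t = seqCode s) : z = [] := by
  rcases z with _ | ⟨a, z⟩
  · rfl
  · have hz : z ++ seqCode t = true :: s.flatMap natBlock := (List.cons.inj h).2
    have hchain := isChain_not_and_true_cons_flatMap_natBlock s
    rw [← hz, List.isChain_append] at hchain
    simp [seqCode] at hchain

open Classical in
/-- The labelled tree whose labels `1` are at the codes of the sequences in `T`: the value at `T` of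
the continuous reduction of well-foundedness to `V`. -/
noncomputable def codeTree (T : List ℕ → Bool) : Tree Bool := fun x =>
  if h : ∃ s, seqCode s = x then T h.choose else false

theorem codeTree_eq_true_iff {T : List ℕ → Bool} {x : Node} :
    codeTree T x = true ↔ ∃ s, T s = true ∧ seqCode s = x := by
  unfold codeTree
  split_ifs with h
  · refine ⟨fun hT => ⟨_, hT, h.choose_spec⟩, ?_⟩
    rintro ⟨s, hT, hs⟩
    rwa [seqCode_injective (h.choose_spec.trans hs.symm)]
  · exact iff_of_false not_false fun ⟨s, _, hs⟩ => h ⟨s, hs⟩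

theorem continuous_codeTree : Continuous codeTree := by
  refine continuous_pi fun x => ?_
  unfold codeTree
  split_ifs
  · exact continuous_apply _
  · exact continuous_const

theorem codeTree_mem_treeV_iff {T : List ℕ → Bool} (hT : PrefixClosed T) :
    codeTree T ∈ treeV ↔ ¬ HasPath T := by
  have hones : {x | codeTree T x = true} = seqCode '' {s | T s = true} :=
    Set.ext fun _ => codeTree_eq_true_iff
  have hchain : ∀ C, IsChain (· <+: ·) (seqCode '' C) ↔ IsChain (· <+: ·) C := fun C =>
    IsChain.image_relEmbedding_iff
      (φ := (⟨⟨seqCode, seqCode_injective⟩, seqCode_prefix_seqCode_iff⟩ :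
        @RelEmbedding (List ℕ) Node (· <+: ·) (· <+: ·)))
  rw [iff_not_comm, hT.hasPath_iff, notMem_treeV_iff, hones]
  simp only [Set.exists_subset_image_iff, Set.infinite_image_iff seqCode_injective.injOn, hchain]

theorem not_analyticSet_treeV : ¬ AnalyticSet treeV := fun h =>
  have : PolishSpace Bool := inferInstance
  not_analyticSet_of_forall_mem_iff_not_hasPath (fun _ => codeTree_mem_treeV_iff)
    (h.preimage continuous_codeTree)

end Coding

/-! ### Analytic presentations -/

section Shifts

variable {A : Type}

/-- The common form of `Left'` and `Right'`: the label of `x` becomes the old label of its child in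
direction `b`. -/
def shift (b : Bool) (v : Tree A) : Tree A := fun y => v (y ++ [b])

/-- The iterated shift, by the letters of `x` from the last to the first. -/
def iterShift (x : Node) (v : Tree A) : Tree A := fun y => v (y ++ x)

theorem iterShift_nil (v : Tree A) : iterShift [] v = v := by
  funext y
  simp [iterShift]

theorem iterShift_cons (b : Bool) (x : Node) (v : Tree A) :
    iterShift (b :: x) v = shift b (iterShift x v) := by
  funext y
  simp [shift, iterShift]

/-- The tree whose only label `1` is at the root. -/
def rootTree : Tree Bool := fun x => decide (x = [])

theorem iterShift_seqCode_codeTree {T : List ℕ → Bool} {s : List ℕ} (hs : T s = true) :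
    iterShift (seqCode s) (codeTree T) = rootTree := by
  funext y
  rw [Bool.eq_iff_iff, iterShift, codeTree_eq_true_iff, rootTree, decide_eq_true_eq]
  constructor
  · rintro ⟨t, -, ht⟩
    exact eq_nil_of_append_seqCode_eq_seqCode ht.symm
  · rintro rfl
    exact ⟨s, hs, rfl⟩

theorem eq_true_of_iterShift_eq_rootTree {x : Node} {v : Tree Bool}
    (h : iterShift x v = rootTree) : v x = true := by
  simpa [iterShift, rootTree] using congrFun h []

theorem codeTree_mem_treeV_iff_exists {T : List ℕ → Bool} :
    codeTree T ∈ treeV ↔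
      ∃ v ∈ treeV, ∀ s, T s = true → iterShift (seqCode s) v = rootTree := by
  constructor
  · exact fun h => ⟨_, h, fun _ => iterShift_seqCode_codeTree⟩
  · rintro ⟨v, hv, hT⟩
    refine treeV_antitone (fun x hx => ?_) hv
    obtain ⟨s, hs, rfl⟩ := codeTree_eq_true_iff.1 hx
    exact eq_true_of_iterShift_eq_rootTree (hT s hs)

theorem analyticSet_inter {X : Type*} [TopologicalSpace X] [T2Space X] {s t : Set X}
    (hs : AnalyticSet s) (ht : AnalyticSet t) : AnalyticSet (s ∩ t) := by
  rw [Set.inter_eq_iInter]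
  exact AnalyticSet.iInter fun b => by cases b <;> assumption

theorem analyticSet_image_iterShift {X : Type*} [TopologicalSpace X] [PolishSpace X]
    {e : Tree A → X} (he : Function.Injective e) {P : Set (Tree A)} (hP : AnalyticSet (e '' P))
    (hshift : ∀ b, AnalyticSet (Set.range fun v => (e v, e (shift b v)))) :
    AnalyticSet ((fun v x => e (iterShift x v)) '' P) := by
  have hlocal : (fun v x => e (iterShift x v)) '' P = (fun β : Node → X => β []) ⁻¹' (e '' P) ∩
      ⋂ q : Bool × Node, (fun β : Node → X => (β q.2, β (q.1 :: q.2))) ⁻¹'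
        Set.range fun v => (e v, e (shift q.1 v)) := by
    ext β
    simp only [Set.mem_image, Set.mem_inter_iff, Set.mem_preimage, Set.mem_iInter, Set.mem_range,
      Prod.mk.injEq]
    constructor
    · rintro ⟨v, hv, rfl⟩
      exact ⟨⟨v, hv, congrArg e (iterShift_nil v).symm⟩, fun q =>
        ⟨_, rfl, congrArg e (iterShift_cons q.1 q.2 v).symm⟩⟩
    · rintro ⟨⟨v, hv, hroot⟩, hstep⟩
      refine ⟨v, hv, funext fun x => ?_⟩
      induction x with
      | nil => rw [iterShift_nil, hroot]
      | cons b x ih =>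
        obtain ⟨w, hw, hbw⟩ := hstep (b, x)
        rw [iterShift_cons, ← hbw, he (ih.trans hw.symm)]
  rw [hlocal]
  exact analyticSet_inter (hP.preimage (continuous_apply _))
    (.iInter fun q => (hshift q.1).preimage (by fun_prop))

end Shifts

section Presentations

variable {X : Type*} {L : FirstOrder.Language.{0, 0}} {M : Type*} [L.Structure M]

open FirstOrder.Language.Structure

theorem StructureIn.mono {C C' : (k : ℕ) → Set (Fin k → X) → Prop} (hC : ∀ k R, C k R → C' k R)
    {e : M → X} (h : StructureIn C L e) : StructureIn C' L e :=
  ⟨hC _ _ h.1, fun n R => hC _ _ (h.2.1 n R), fun n f => hC _ _ (h.2.2 n f)⟩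

theorem HasPresentation.mono {C C' : (k : ℕ) → Set (Fin k → X) → Prop}
    (hC : ∀ k R, C k R → C' k R) : HasPresentation C L M → HasPresentation C' L M :=
  fun ⟨D, hD, h, hiso⟩ => ⟨D, hD, h.mono hC, hiso⟩

theorem HasPresentation.exists_injective {C : (k : ℕ) → Set (Fin k → X) → Prop}
    (h : HasPresentation C L M) : ∃ e : M → X, Function.Injective e ∧ StructureIn C L e := by
  obtain ⟨D, _, ⟨hdom, hrel, hfun⟩, ⟨Φ⟩⟩ := h
  have hsurj : ∀ n, Function.Surjective fun (a : Fin n → M) => Φ ∘ a := fun n =>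
    Φ.surjective.comp_left
  refine ⟨fun a => Φ a, Subtype.val_injective.comp Φ.injective, ?_, fun n R => ?_, fun n f => ?_⟩
  · simpa only [Φ.surjective.exists] using hdom
  · simpa only [(hsurj n).exists, Φ.map_rel, Function.comp_apply] using hrel n R
  · simpa only [(hsurj n).exists, Φ.map_fun, Function.comp_apply] using hfun n f

/-- `M` is isomorphic to a structure with domain an analytic subset of `X` and with analytic basic
relations and graphs of basic functions. -/
def HasAnalyticPresentation (X : Type*) [TopologicalSpace X] (L : FirstOrder.Language.{0, 0})
    (M : Type*) [L.Structure M] : Prop :=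
  HasPresentation (fun k (R : Set (Fin k → X)) => AnalyticSet R) L M

variable [TopologicalSpace X] [PolishSpace X] {e : M → X}

theorem StructureIn.analyticSet_image_relation
    (h : StructureIn (fun k (R : Set (Fin k → X)) => AnalyticSet R) L e) (R : L.Relations 1) :
    AnalyticSet (e '' {a | RelMap R ![a]}) := by
  convert (h.2.1 1 R).preimage (f := fun b _ => b) (by fun_prop) using 1
  ext b
  refine .trans (exists_congr fun a => and_congr_right' ?_)
    (FinVec.exists_iff fun a : Fin 1 → M => RelMap R a ∧ (fun _ => b) = fun i => e (a i))
  simp [funext_iff, eq_comm]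

theorem StructureIn.analyticSet_range_function
    (h : StructureIn (fun k (R : Set (Fin k → X)) => AnalyticSet R) L e) (f : L.Functions 1) :
    AnalyticSet (Set.range fun a => (e a, e (funMap f ![a]))) := by
  convert (h.2.2 1 f).preimage (f := fun p : X × X => ![p.1, p.2]) (by fun_prop) using 1
  ext p
  refine .trans (exists_congr fun a => ?_) (FinVec.exists_iff fun a : Fin 1 → M =>
    ![p.1, p.2] = Fin.snoc (α := fun _ => X) (fun i => e (a i)) (e (funMap f a)))
  change _ ↔ ![p.1, p.2] = Fin.snoc (α := fun _ => X) (fun i => e (![a] i)) (e (funMap f ![a]))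
  simp [funext_iff, Prod.ext_iff, Fin.forall_fin_two, Fin.snoc, eq_comm]

end Presentations

theorem not_hasAnalyticPresentation_treeLang (X : Type*) [TopologicalSpace X] [PolishSpace X] :
    ¬ HasAnalyticPresentation X treeLang (Tree Bool) := by
  intro hX
  obtain ⟨e, he, h⟩ := hX.exists_injective
  have hshift : ∀ b, AnalyticSet (Set.range fun v => (e v, e (shift b v))) := by
    rintro (_ | _)
    · exact h.analyticSet_range_function TreeFun.left
    · exact h.analyticSet_range_function TreeFun.right
  have hcodes : AnalyticSet ((fun v x => e (iterShift x v)) '' treeV) :=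
    analyticSet_image_iterShift he (h.analyticSet_image_relation TreeRel.V) hshift
  have hclosed : IsClosed {p : (List ℕ → Bool) × (Node → X) |
      ∀ s, p.1 s = true → p.2 (seqCode s) = e rootTree} := by
    simp only [Set.ofPred_forall]
    refine isClosed_iInter fun s => ?_
    have hopen : IsOpen {p : (List ℕ → Bool) × (Node → X) | p.1 s = true} :=
      (isOpen_discrete {true}).preimage (by fun_prop)
    exact isClosed_imp hopen (isClosed_eq (by fun_prop) (by fun_prop))
  have : PolishSpace Bool := inferInstance
  refine not_analyticSet_of_forall_mem_iff_not_hasPath (fun T hT => ?_)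
    ((analyticSet_inter hclosed.analyticSet (hcodes.preimage continuous_snd)).image_of_continuous
      continuous_fst)
  rw [← codeTree_mem_treeV_iff hT, codeTree_mem_treeV_iff_exists]
  simp [he.eq_iff, and_comm]

/-! ### Borel sets and Büchi languages are analytic -/

theorem analyticSet_of_measurableSet_borel {X : Type*} [TopologicalSpace X] [PolishSpace X]
    {s : Set X} (hs : @MeasurableSet X (borel X) s) : AnalyticSet s := by
  borelize X
  exact hs.analyticSet

theorem HasBorelPresentation.hasAnalyticPresentation {X : Type*} [TopologicalSpace X]
    [PolishSpace X] {L : FirstOrder.Language.{0, 0}} {M : Type*} [L.Structure M]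
    (h : HasBorelPresentation X L M) : HasAnalyticPresentation X L M :=
  h.mono fun _ _ => analyticSet_of_measurableSet_borel

theorem measurableSet_infinite {Y : Type*} [MeasurableSpace Y] {p : ℕ → Y → Prop}
    (hp : ∀ i, MeasurableSet {y | p i y}) : MeasurableSet {y | {i | p i y}.Infinite} := by
  have hlimsup := MeasurableSet.measurableSet_limsup hp
  rwa [← Nat.cofinite_eq_atTop, cofinite.limsup_set_eq] at hlimsup

theorem BuchiAutomaton.analyticSet_accepts {A : Type} [TopologicalSpace A] [DiscreteTopology A]
    [Countable A] (M : BuchiAutomaton A) : AnalyticSet {α | M.Accepts α} := by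
  have := M.finite_state
  let : TopologicalSpace M.State := ⊥
  have : DiscreteTopology M.State := ⟨rfl⟩
  have : PolishSpace A := inferInstance
  have : PolishSpace M.State := inferInstance
  let : MeasurableSpace ((ℕ → A) × (ℕ → M.State)) := borel _
  have : BorelSpace ((ℕ → A) × (ℕ → M.State)) := ⟨rfl⟩
  have hinit : MeasurableSet {p : (ℕ → A) × (ℕ → M.State) | p.2 0 = M.init} :=
    (isClosed_eq (by fun_prop) (by fun_prop)).measurableSet
  have htrans : MeasurableSet {p : (ℕ → A) × (ℕ → M.State) |
      ∀ i, (p.2 i, p.1 i, p.2 (i + 1)) ∈ M.trans} := by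
    rw [Set.ofPred_forall]
    exact .iInter fun i => ((isClosed_discrete M.trans).preimage (by fun_prop)).measurableSet
  have hacc : MeasurableSet {p : (ℕ → A) × (ℕ → M.State) |
      ∃ s ∈ M.acc, {i | p.2 i = s}.Infinite} := by
    simp only [Set.ofPred_exists]
    refine .iUnion fun s => .inter (.const _) (measurableSet_infinite fun i => ?_)
    exact (isClosed_eq (by fun_prop) (by fun_prop)).measurableSet
  convert (hinit.inter (htrans.inter hacc)).analyticSet.image_of_continuous continuous_fst using 1
  ext α
  simp [BuchiAutomaton.Accepts]

theorem BuchiRecognizable.analyticSet {A : Type} [TopologicalSpace A] [DiscreteTopology A]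
    [Finite A] {k : ℕ} {R : Set (Fin k → Word A)} (hR : BuchiRecognizable A k R) :
    AnalyticSet R := by
  obtain ⟨M, hM⟩ := hR
  have hconv : Function.Injective (conv : (Fin k → Word A) → Word (Fin k → A)) :=
    fun x y hxy => funext fun j => funext fun p => congrFun (congrFun hxy p) j
  have : PolishSpace A := inferInstance
  rw [← hconv.preimage_image R, ← hM]
  exact M.analyticSet_accepts.preimage (by unfold conv; fun_prop)

theorem HasBuchiPresentation.exists_hasAnalyticPresentation {L : FirstOrder.Language.{0, 0}}
    {M : Type*} [L.Structure M] (h : HasBuchiPresentation L M) :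
    ∃ (X : Type) (_ : TopologicalSpace X) (_ : PolishSpace X), HasAnalyticPresentation X L M := by
  obtain ⟨A, _, hA⟩ := h
  let : TopologicalSpace A := ⊥
  have : DiscreteTopology A := ⟨rfl⟩
  have : PolishSpace A := inferInstance
  exact ⟨Word A, inferInstance, inferInstance, hA.mono fun _ _ => BuchiRecognizable.analyticSet⟩

/-! ### Rabin automata for the basic relations -/

section Rabin

theorem rabinRecognizable_of_accepts_iff {A : Type} {k : ℕ} {R : Set (Fin k → Tree A)}
    (M : RabinAutomaton (Fin k → A)) (h : ∀ x : Fin k → Tree A, M.Accepts (conv x) ↔ x ∈ R) :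
    RabinRecognizable A k R := by
  refine ⟨M, Set.ext fun v => ⟨fun hv => ⟨fun j p => v p j, (h _).1 hv, rfl⟩, ?_⟩⟩
  rintro ⟨x, hx, rfl⟩
  exact (h x).2 hx

theorem rabinRecognizable_univ (A : Type) (k : ℕ) :
    RabinRecognizable A k (Set.univ : Set (Fin k → Tree A)) :=
  rabinRecognizable_of_accepts_iff
    { State := Unit
      finite_state := inferInstance
      init := ()
      trans := Set.univ
      acc := Set.univ }
    fun _ => ⟨fun _ => trivial, fun _ => ⟨fun _ => (), ⟨rfl, fun _ => trivial⟩, fun _ => trivial⟩⟩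

/-- An automaton recognizing the graph of `shift b`: a state is the label that the first tree must
have at the current node, or `none` if nothing is required there. -/
def shiftAutomaton (A : Type) [Finite A] (b : Bool) : RabinAutomaton (Fin 2 → A) where
  State := Option A
  finite_state := inferInstance
  init := none
  trans := {q | (∀ a ∈ q.1, q.2.1 0 = a) ∧ (if b then q.2.2.2 else q.2.2.1) = some (q.2.1 1)}
  acc := Set.univ

theorem rabinRecognizable_shift (A : Type) [Finite A] (b : Bool) :
    RabinRecognizable A 2 {x | x 1 = shift b (x 0)} := by
  refine rabinRecognizable_of_accepts_iff (shiftAutomaton A b) fun x => ⟨?_, fun h => ?_⟩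
  · rintro ⟨r, ⟨-, hr⟩, -⟩
    refine funext fun y => ?_
    have hchild : r (y ++ [b]) = some (x 1 y) := by cases b <;> exact (hr y).2
    exact ((hr (y ++ [b])).1 _ hchild).symm
  · refine ⟨fun y => if y = [] then none else some (x 0 y), ⟨rfl, fun y => ⟨?_, ?_⟩⟩,
      fun _ => trivial⟩
    · rintro a (ha : a ∈ if y = [] then none else some (x 0 y))
      exact Option.some.inj (Option.mem_ite_none_left.1 ha).2
    · have hchild : x 1 y = x 0 (y ++ [b]) := congrFun h y
      cases b <;> simp [conv, Node.left, Node.right, hchild]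

/-- The automaton with the given initial state and transitions whose accepting runs are those in
which `true` occurs only finitely often on every path. -/
def finitelyTrueAutomaton {A : Type} (init : Bool) (trans : Set (Bool × A × Bool × Bool)) :
    RabinAutomaton A where
  State := Bool
  finite_state := inferInstance
  init := init
  trans := trans
  acc := {F | true ∉ F}

theorem finitelyTrueAutomaton_accepts_iff {A : Type} {init : Bool}
    {trans : Set (Bool × A × Bool × Bool)} {v : Tree A} :
    (finitelyTrueAutomaton init trans).Accepts v ↔ ∃ r ∈ treeV, r [] = init ∧
      ∀ x, (r x, v x, r (x ++ [false]), r (x ++ [true])) ∈ trans := by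
  refine exists_congr fun r => and_comm.trans (and_congr_left' ?_)
  exact forall_congr' fun η => Set.not_infinite

theorem mem_treeV_iff_of_concat {r v : Tree Bool} (h : ∀ x b, r (x ++ [b]) = v x) :
    r ∈ treeV ↔ v ∈ treeV := by
  have hfin : ∀ p : ℕ → Prop, {n | p n}.Finite ↔ ∀ᶠ n in atTop, ¬ p n := fun p => by
    rw [← Nat.cofinite_eq_atTop, eventually_cofinite]
    simp only [not_not]
  refine forall_congr' fun η => ?_
  rw [hfin, hfin]
  conv_lhs => rw [← map_add_atTop_eq_nat 1, eventually_map]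
  simp only [initSeg_succ, h]

theorem rabinRecognizable_treeV : RabinRecognizable Bool 1 {x | x 0 ∈ treeV} := by
  refine rabinRecognizable_of_accepts_iff (finitelyTrueAutomaton false
    {q | q.2.2.1 = q.2.1 0 ∧ q.2.2.2 = q.2.1 0}) fun x => ?_
  rw [finitelyTrueAutomaton_accepts_iff]
  constructor
  · rintro ⟨r, hr, -, hstep⟩
    refine (mem_treeV_iff_of_concat fun y b => ?_).1 hr
    cases b
    exacts [(hstep y).1, (hstep y).2]
  · intro hx
    exact ⟨fun y => decide (y ≠ []) && x 0 y.dropLast,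
      (mem_treeV_iff_of_concat (by simp)).2 hx, by simp, by simp [conv]⟩

/-- The transitions of an automaton whose state says whether the only label `1` is at or below the
current node: this node has at most one of label `1` and a marked child, and is marked if it has one
of them. -/
def singletonTrans : Set (Bool × Bool × Bool × Bool) :=
  {(false, false, false, false), (true, true, false, false), (true, false, true, false),
    (true, false, false, true)}

theorem mem_treeS_of_singletonTrans {r v : Tree Bool} (hr : r ∈ treeV) (hroot : r [] = true)
    (hstep : ∀ x, (r x, v x, r (x ++ [false]), r (x ++ [true])) ∈ singletonTrans) : v ∈ treeS := by
  simp only [singletonTrans, Set.mem_insert_iff, Set.mem_singleton_iff, Prod.mk.injEq] at hstep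
  have hup : ∀ x b, r (x ++ [b]) = true → r x = true := fun x b => by
    rcases hstep x with h | h | h | h <;> cases b <;> simp [h]
  have hchild : ∀ x a b, r (x ++ [a]) = true → r (x ++ [b]) = true → a = b := fun x a b => by
    rcases hstep x with h | h | h | h <;> cases a <;> cases b <;> simp [h]
  have hdown : ∀ x, r x = true → v x = true ∨ ∃ b, r (x ++ [b]) = true := fun x => by
    rcases hstep x with h | h | h | h <;> simp [h]
  have hlabel : ∀ x, v x = true → r x = true ∧ ∀ b, r (x ++ [b]) = false := fun x => by
    rcases hstep x with h | h | h | h <;> simp [h]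
  have hclosed : PrefixClosed r := prefixClosed_of_forall_concat hup
  have hchain := hclosed.isChain_of_subsingleton_children hchild
  have hlast : ∀ x y, v x = true → r y = true → y <+: x := by
    intro x y hx hy
    rcases hchain.total (hlabel x hx).1 hy with ⟨_ | ⟨b, z⟩, rfl⟩ | hyx
    · simp
    · rw [List.append_cons] at hy
      simpa [(hlabel x hx).2 b] using hclosed _ _ hy
    · exact hyx
  obtain ⟨x, hx, hmax⟩ := Set.exists_max_image _ List.length
    (finite_of_mem_treeV_of_isChain hr hchain) ⟨[], hroot⟩
  have hvx : v x = true := (hdown x hx).resolve_right fun ⟨b, hb⟩ => by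
    simpa using hmax _ hb
  exact ⟨x, hvx, fun y hy => antisymm (r := (· <+: ·)) (hlast x y hvx (hlabel y hy).1)
    (hlast y x hy hx)⟩

theorem mem_singletonTrans_prefix {v : Tree Bool} {z : Node} (hz : ∀ x, v x = true ↔ x = z)
    (x : Node) : (decide (x <+: z), v x, decide (x ++ [false] <+: z),
      decide (x ++ [true] <+: z)) ∈ singletonTrans := by
  by_cases hxz : x <+: z
  · obtain ⟨_ | ⟨b, y⟩, rfl⟩ := hxz
    · have hv : v x = true := by simp [hz]
      have hchild : ∀ b, ¬ x ++ [b] <+: x := fun b hb => by simpa using hb.length_le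
      simp [singletonTrans, hv, hchild]
    · have hv : v x = false := by simp [← Bool.not_eq_true, hz]
      cases b <;> simp [singletonTrans, hv, List.prefix_append_right_inj]
  · have hv : v x = false := by
      rw [← Bool.not_eq_true, hz]
      exact fun h => hxz (h ▸ List.prefix_rfl)
    have hchild : ∀ b, ¬ x ++ [b] <+: z := fun b hb => hxz ((List.prefix_append _ _).trans hb)
    simp [singletonTrans, hxz, hv, hchild]

theorem rabinRecognizable_treeS : RabinRecognizable Bool 1 {x | x 0 ∈ treeS} := by
  refine rabinRecognizable_of_accepts_iff (finitelyTrueAutomaton true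
    {q | (q.1, q.2.1 0, q.2.2) ∈ singletonTrans}) fun x => ?_
  rw [finitelyTrueAutomaton_accepts_iff]
  constructor
  · rintro ⟨r, hr, hroot, hstep⟩
    exact mem_treeS_of_singletonTrans hr hroot hstep
  · rintro ⟨z, hz, hunique⟩
    refine ⟨fun y => decide (y <+: z), fun η => ?_, by simp,
      mem_singletonTrans_prefix fun y => ⟨hunique y, fun h => h ▸ hz⟩⟩
    exact (Set.finite_Iic z.length).subset fun n hn => by
      simpa using (of_decide_eq_true hn).length_le

end Rabin

theorem structureIn_id {M : Type*} {L : FirstOrder.Language.{0, 0}} [L.Structure M]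
    {C : (k : ℕ) → Set (Fin k → M) → Prop} (huniv : C 1 Set.univ)
    (hrel : ∀ n (R : L.Relations n), C n {x | FirstOrder.Language.Structure.RelMap R x})
    (hfun : ∀ n (f : L.Functions n),
      C (n + 1) {x | x (Fin.last n) = FirstOrder.Language.Structure.funMap f (Fin.init x)}) :
    StructureIn C L (id : M → M) := by
  refine ⟨?_, fun n R => ?_, fun n f => ?_⟩
  · convert huniv
    refine Set.eq_univ_of_forall fun x => ⟨x 0, funext fun i => ?_⟩
    rw [Subsingleton.elim i 0, id]
  · convert hrel n R using 1
    ext x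
    simp only [id, Set.mem_ofPred_eq, exists_eq_right']
  · convert hfun n f using 1
    ext x
    constructor
    · rintro ⟨a, rfl⟩
      simp
    · intro hx
      exact ⟨Fin.init x, by rw [id, ← hx]; exact (Fin.snoc_init_self x).symm⟩

theorem isRabinAutomatic_treeLang : IsRabinAutomatic Bool treeLang := by
  refine structureIn_id (rabinRecognizable_univ Bool 1) (fun n R => ?_) fun n f => ?_
  · cases R
    exacts [rabinRecognizable_treeS, rabinRecognizable_treeV]
  · cases f
    exacts [rabinRecognizable_shift Bool false, rabinRecognizable_shift Bool true]

end AutStr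

theorem mainTheorem7_general :
    AutStr.IsRabinAutomatic Bool AutStr.treeLang ∧
    (∀ (X : Type*) [TopologicalSpace X] [PolishSpace X],
      ¬ AutStr.HasAnalyticPresentation X AutStr.treeLang (AutStr.Tree Bool)) ∧
    (∃ f : (List ℕ → Bool) → AutStr.Tree Bool, Continuous f ∧
      ∀ T, AutStr.PrefixClosed T → (f T ∈ AutStr.treeV ↔ ¬ AutStr.HasPath T)) ∧
    ¬ MeasureTheory.AnalyticSet AutStr.treeV :=
  ⟨AutStr.isRabinAutomatic_treeLang, AutStr.not_hasAnalyticPresentation_treeLang,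
    ⟨AutStr.codeTree, AutStr.continuous_codeTree, fun _ => AutStr.codeTree_mem_treeV_iff⟩,
    AutStr.not_analyticSet_treeV⟩

theorem mainTheorem7 :
    -- the structure of all labelled trees with `S`, `V`, `Left'`, `Right'` is Rabin automatic
    AutStr.IsRabinAutomatic Bool AutStr.treeLang ∧
    -- it has no Borel presentation, in Cantor space or in any other Polish space
    (∀ (X : Type) [TopologicalSpace X] [PolishSpace X],
      ¬ AutStr.HasBorelPresentation X AutStr.treeLang (AutStr.Tree Bool)) ∧
    -- it has no Büchi automatic presentation
    ¬ AutStr.HasBuchiPresentation AutStr.treeLang (AutStr.Tree Bool) ∧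
    -- well-foundedness of trees of finite sequences of natural numbers reduces continuously to `V`
    (∃ f : (List ℕ → Bool) → AutStr.Tree Bool, Continuous f ∧
      ∀ T : List ℕ → Bool, (∀ s t : List ℕ, T (s ++ t) = true → T s = true) →
        (f T ∈ AutStr.treeV ↔ ¬ ∃ α : ℕ → ℕ, ∀ n, T (AutStr.initSeg α n) = true)) ∧
    -- `V` is not Borel
    ¬ @MeasurableSet (AutStr.Tree Bool) (borel (AutStr.Tree Bool)) AutStr.treeV := by
  obtain ⟨hrabin, hpres, hreduction, hV⟩ := mainTheorem7_general
  have : PolishSpace Bool := inferInstance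
  refine ⟨hrabin, fun X _ _ h => hpres X h.hasAnalyticPresentation, fun h => ?_, hreduction,
    fun h => hV (AutStr.analyticSet_of_measurableSet_borel h)⟩
  obtain ⟨X, _, _, hX⟩ := h.exists_hasAnalyticPresentation
  exact hpres X hX
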